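/- For complex numbers $a_1,\dots,a_{q+1}$ and $b_1,\dots,b_q\notin\{0,-1,-2,\dots\}$ let $${}_{q+1}F_q(a_1,\dots,a_{q+1};b_1,\dots,b_q;1)=\sum_{n=0}^\infty\frac{(a_1)_n\cdots(a_{q+1})_n}{(b_1)_n\cdots(b_q)_n\,n!},\qquad (x)_n=x(x+1)\cdots(x+n-1),$$ and let $\Gamma$, $\Psi=\Gamma'/\Gamma$ and $\gamma$ be the gamma function, the digamma function and Euler's constant. Let $c,d\in\mathbb{C}$ satisfy $\operatorname{Re}(c+d)<4$, and assume that $c\notin\{1,0,-1,-2,\dots\}$, $d\notin\{1,2,3,\dots\}$ and $1+c-d\notin\{0,-1,-2,\dots\}$. Then the two hypergeometric series below converge absolutely, and $${}_4F_3(1,1,c,d;2,2,2;1)=-\frac{\sin(\pi c)\,\Gamma(c)\,\Gamma(1-d)\;{}_3F_2(c-1,c-1,c-1;\,c,1+c-d;\,1)}{\Gamma(1+c-d)\,(c-1)^3\,\pi}-\frac{2\gamma+\Psi(c-1)+\Psi(2-d)}{(c-1)(d-1)}.$$ -/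

import Mathlib

/-- The `n`-th term `((a₁)ₙ ⋯ (a_p)ₙ) / ((b₁)ₙ ⋯ (b_q)ₙ) * zⁿ / n!` of the generalized
hypergeometric series with top parameters `as` and bottom parameters `bs`. Here `(x)ₙ` is the
rising factorial `x (x + 1) ⋯ (x + n - 1)`. -/
noncomputable def hypergeomTerm (as bs : List ℂ) (z : ℂ) (n : ℕ) : ℂ :=
  (as.map fun x => (ascPochhammer ℂ n).eval x).prod /
    (bs.map fun x => (ascPochhammer ℂ n).eval x).prod * (z ^ n / (n.factorial : ℂ))

/-- The generalized hypergeometric function `_pF_q(as; bs; z)`, as the sum of its series. -/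
noncomputable def hypergeom (as bs : List ℂ) (z : ℂ) : ℂ :=
  ∑' n : ℕ, hypergeomTerm as bs z n

open Complex Filter Topology

/-! Put `a = c - 1`, `b = d - 1`. Up to the factor `1 / (a b)`, the `₄F₃` is `∑_{m ≥ 1} (a)ₘ (b)ₘ /
(m · m!²)`, and the `₃F₂` is a multiple of `∑ (a)ₙ³ / (n! Γ(a + n + 1) Γ(a - b + n + 1))`.

For real `0 < a, b < 1` the link is the product of beta integrals `B(a - ε, 1 - a) B(ε, 1 - b)`.
Splitting the unit square along its diagonal and expanding the inner integrand by the binomial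
series turns the product into a sum of two series (`beta_mul_beta_eq_tsum_add_tsum`). As a function
of `ε` this is a partial fraction expansion of a ratio of gamma functions, with poles at `ε = -m`
and `ε = a + n` (`Gamma_partial_fraction`). Removing the `m = 0` term `1 / ε` and letting `ε → 0⁺`
leaves the derivative of a gamma ratio at `0`, which supplies `γ` and the two digamma values
(`tsum_upperTerm_eq_of_mem_Ioo`).

The general case is analytic continuation. Dividing by `Γ(a) Γ(1 - b)` removes all poles, locally
uniform majorants make both series holomorphic on `re (a + b) < 2`, and the identity theorem is
applied to one variable at a time (`regularizedDefect_eq_zero`). The reflection formula then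
produces the sine. -/

/-! ### Uniform growth of Pochhammer symbols and of `1 / Γ`. -/

theorem norm_one_add_mul_exp_neg_re_le (w : ℂ) : ‖1 + w‖ * Real.exp (-w.re) ≤ Real.exp (‖w‖ ^ 2) := by
  have h1 : ‖1 + w‖ ^ 2 ≤ Real.exp (w.re + ‖w‖ ^ 2) ^ 2 := by
    rw [← Real.exp_nat_mul, Complex.sq_norm, Complex.sq_norm, Complex.normSq_apply,
      Complex.normSq_apply]
    have := Real.add_one_le_exp (((2 : ℕ) : ℝ) * (w.re + (w.re * w.re + w.im * w.im)))
    simp only [add_re, one_re, add_im, one_im] at *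
    push_cast at *
    nlinarith [mul_self_nonneg w.re, mul_self_nonneg w.im]
  have h2 := (le_abs_self _).trans (abs_le_of_sq_le_sq h1 (Real.exp_pos _).le)
  calc _ ≤ Real.exp (w.re + ‖w‖ ^ 2) * Real.exp (-w.re) := by gcongr
    _ = _ := by rw [← Real.exp_add]; congr 1; ring

/-- Write `1 / (1 + w) = 1 + v` with `v = -w + w² / (1 + w)` and apply the previous bound to `v`.
The constant is `6 = 4 + 2`, from `‖v‖² ≤ 4 ‖w‖²` and `re (v + w) ≤ 2 ‖w‖²`. -/
theorem norm_inv_one_add_mul_exp_re_le (w : ℂ) (hw : ‖w‖ ≤ 1 / 2) :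
    ‖(1 + w)⁻¹‖ * Real.exp w.re ≤ Real.exp (6 * ‖w‖ ^ 2) := by
  have hne : 1 + w ≠ 0 := by
    intro h
    have : w = -1 := by linear_combination h
    rw [this] at hw; norm_num at hw
  have h1 : 1 / 2 ≤ ‖1 + w‖ := by
    have := norm_sub_norm_le (1 : ℂ) (-w)
    simp only [norm_one, norm_neg, sub_neg_eq_add] at this
    linarith
  set v := -w / (1 + w) with hv
  have e1 : (1 + w)⁻¹ = 1 + v := by rw [hv]; field_simp; ring
  have e2 : v = -w + w ^ 2 / (1 + w) := by rw [hv]; field_simp; ring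
  have h3 : ‖w ^ 2 / (1 + w)‖ ≤ 2 * ‖w‖ ^ 2 := by
    rw [norm_div, norm_pow, div_le_iff₀ (by linarith)]
    nlinarith [sq_nonneg ‖w‖]
  have h4 : ‖v‖ ≤ 2 * ‖w‖ := by
    rw [hv, norm_div, norm_neg, div_le_iff₀ (by linarith)]
    nlinarith [norm_nonneg w]
  have h5 : v.re ≤ -w.re + 2 * ‖w‖ ^ 2 := by
    have := (Complex.re_le_norm (w ^ 2 / (1 + w))).trans h3
    rw [e2, add_re, neg_re]; linarith
  have h6 := norm_one_add_mul_exp_neg_re_le v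
  rw [e1]
  have : Real.exp w.re = Real.exp (-v.re) * Real.exp (w.re + v.re) := by
    rw [← Real.exp_add]; congr 1; ring
  rw [this, ← mul_assoc]
  calc _ ≤ Real.exp (‖v‖ ^ 2) * Real.exp (w.re + v.re) := by gcongr
    _ = Real.exp (‖v‖ ^ 2 + (w.re + v.re)) := (Real.exp_add _ _).symm
    _ ≤ _ := by
      apply Real.exp_le_exp.2
      nlinarith [norm_nonneg v, norm_nonneg w]

/-- A discrete Grönwall argument: the growth factors have a convergent product, and compactness
bounds the finitely many functions before the recursion starts. -/
theorem exists_bound_of_succ_le_mul_exp {X : Type*} [TopologicalSpace X] {S : Set X}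
    (hS : IsCompact S) {g : ℕ → X → ℝ} (hg : ∀ n, ContinuousOn (g n) S)
    {K : ℕ} {M : ℝ} (hM : 0 ≤ M)
    (h : ∀ n ≥ K, ∀ z ∈ S, g (n + 1) z ≤ g n z * Real.exp (M / ((n : ℝ) + 1) ^ 2)) :
    ∃ C, 0 ≤ C ∧ ∀ n, ∀ z ∈ S, g n z ≤ C := by
  have hb : ∀ n, ∃ C, ∀ z ∈ S, g n z ≤ C := fun n => by
    obtain ⟨C, hC⟩ := hS.exists_bound_of_continuousOn (hg n)
    exact ⟨C, fun z hz => (le_abs_self _).trans (hC z hz)⟩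
  choose B hB using hb
  set B' : ℝ := ∑ k ∈ Finset.range (K + 1), |B k| with hB'
  have hB0 : 0 ≤ B' := Finset.sum_nonneg fun _ _ => abs_nonneg _
  have hsum : Summable fun n : ℕ => M / ((n : ℝ) + 1) ^ 2 := by
    have := (summable_nat_add_iff 1).2 (Real.summable_one_div_nat_pow.2 one_lt_two)
    simpa [div_eq_mul_inv] using this.mul_left M
  have hterm : ∀ n : ℕ, 0 ≤ M / ((n : ℝ) + 1) ^ 2 := fun n => by positivity
  have hle : ∀ k, k ≤ K → ∀ z ∈ S, g k z ≤ B' := fun k hk z hz =>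
    (hB k z hz).trans <| (le_abs_self _).trans <|
      Finset.single_le_sum (f := fun k => |B k|) (fun _ _ => abs_nonneg _)
        (Finset.mem_range.2 (by omega))
  have key : ∀ n, ∀ z ∈ S, g n z ≤
      B' * Real.exp (∑ k ∈ Finset.range n, M / ((k : ℝ) + 1) ^ 2) := by
    intro n
    induction n with
    | zero => intro z hz; simpa using hle 0 (by omega) z hz
    | succ n ih =>
      intro z hz
      by_cases hn : n + 1 ≤ K
      · refine (hle _ hn z hz).trans (le_mul_of_one_le_right hB0 ?_)
        exact Real.one_le_exp (Finset.sum_nonneg fun _ _ => hterm _)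
      · refine (h n (by omega) z hz).trans ?_
        rw [Finset.sum_range_succ, Real.exp_add, ← mul_assoc]
        gcongr
        exact ih z hz
  refine ⟨B' * Real.exp (∑' k : ℕ, M / ((k : ℝ) + 1) ^ 2), by positivity, fun n z hz => ?_⟩
  refine (key n z hz).trans ?_
  gcongr
  exact hsum.sum_le_tsum _ fun _ _ => hterm _

theorem harmonic_succ_real (n : ℕ) : (harmonic (n + 1) : ℝ) = harmonic n + 1 / ((n : ℝ) + 1) := by
  rw [harmonic_succ]; push_cast; simp

/-- Measuring growth by `exp` of harmonic numbers instead of powers of `n` makes the linear term of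
each ratio `1 + (z - 1) / (n + 1)` cancel exactly; only an `O(1 / (n + 1)²)` error is left. -/
theorem exists_norm_ascPochhammer_div_factorial_le (R : ℝ) :
    ∃ C, 0 ≤ C ∧ ∀ n : ℕ, ∀ z : ℂ, ‖z‖ ≤ R →
      ‖(ascPochhammer ℂ n).eval z / n.factorial‖ ≤ C * Real.exp ((z.re - 1) * harmonic n) := by
  suffices ∃ C, 0 ≤ C ∧ ∀ n : ℕ, ∀ z ∈ Metric.closedBall (0 : ℂ) R,
      ‖(ascPochhammer ℂ n).eval z / n.factorial‖ * Real.exp (-((z.re - 1) * harmonic n)) ≤ C by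
    obtain ⟨C, hC0, hC⟩ := this
    refine ⟨C, hC0, fun n z hz => ?_⟩
    have := hC n z (by simpa using hz)
    rwa [Real.exp_neg, ← div_eq_mul_inv, div_le_iff₀ (Real.exp_pos _)] at this
  refine exists_bound_of_succ_le_mul_exp (isCompact_closedBall (0 : ℂ) R)
    (fun n => by fun_prop) (K := 0) (M := (|R| + 1) ^ 2) (by positivity)
    fun n _ z hz => ?_
  · have hz' : ‖z‖ ≤ R := by simpa using hz
    have hn : (n : ℂ) + 1 ≠ 0 := Nat.cast_add_one_ne_zero n
    have hf : (n.factorial : ℂ) ≠ 0 := by exact_mod_cast n.factorial_ne_zero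
    set w : ℂ := (z - 1) / ((n : ℂ) + 1) with hw
    have e1 : (ascPochhammer ℂ (n + 1)).eval z / ((n + 1).factorial : ℂ) =
        (ascPochhammer ℂ n).eval z / n.factorial * (1 + w) := by
      rw [ascPochhammer_succ_eval, Nat.factorial_succ, hw]
      push_cast
      field_simp
      ring
    have e2 : w.re = (z.re - 1) / ((n : ℝ) + 1) := by
      have : w = (z - 1) / (((n : ℝ) + 1 : ℝ) : ℂ) := by rw [hw]; push_cast; rfl
      rw [this, Complex.div_ofReal_re]; simp
    have e3 : ‖w‖ ^ 2 ≤ (|R| + 1) ^ 2 / ((n : ℝ) + 1) ^ 2 := by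
      have h1 : ‖(n : ℂ) + 1‖ = (n : ℝ) + 1 := by
        have := Complex.norm_natCast (n + 1); push_cast at this; exact this
      rw [hw, norm_div, div_pow, h1]
      gcongr
      exact (norm_sub_le _ _).trans (by simpa using hz'.trans (le_abs_self R))
    have e4 : Real.exp (-((z.re - 1) * (harmonic (n + 1) : ℝ))) =
        Real.exp (-((z.re - 1) * harmonic n)) * Real.exp (-w.re) := by
      rw [← Real.exp_add, harmonic_succ_real, e2]; congr 1; ring
    rw [e1, e4, norm_mul]
    calc _ = (‖(ascPochhammer ℂ n).eval z / n.factorial‖ * Real.exp (-((z.re - 1) * harmonic n))) *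
          (‖1 + w‖ * Real.exp (-w.re)) := by ring
      _ ≤ _ := by
        gcongr
        exact (norm_one_add_mul_exp_neg_re_le w).trans (Real.exp_le_exp.2 e3)

theorem continuous_inv_Gamma : Continuous fun z : ℂ => (Gamma z)⁻¹ :=
  differentiable_one_div_Gamma.continuous

theorem exists_norm_factorial_div_Gamma_le (R : ℝ) :
    ∃ C, 0 ≤ C ∧ ∀ n : ℕ, ∀ z : ℂ, ‖z‖ ≤ R →
      ‖(n.factorial : ℂ) * (Gamma (z + n + 1))⁻¹‖ ≤ C * Real.exp (-z.re * harmonic n) := by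
  suffices ∃ C, 0 ≤ C ∧ ∀ n : ℕ, ∀ z ∈ Metric.closedBall (0 : ℂ) R,
      ‖(n.factorial : ℂ) * (Gamma (z + n + 1))⁻¹‖ * Real.exp (z.re * harmonic n) ≤ C by
    obtain ⟨C, hC0, hC⟩ := this
    refine ⟨C, hC0, fun n z hz => ?_⟩
    have := hC n z (by simpa using hz)
    rw [neg_mul, Real.exp_neg]
    exact (le_div_iff₀ (Real.exp_pos _)).2 this
  -- Beyond `2 |R|` one has `‖z / (n + 1)‖ ≤ 1 / 2`, as the bound for `(1 + w)⁻¹` requires.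
  refine exists_bound_of_succ_le_mul_exp (isCompact_closedBall (0 : ℂ) R)
    (fun n => Continuous.continuousOn ?_) (K := ⌈2 * |R|⌉₊)
    (M := 6 * |R| ^ 2) (by positivity) fun n hn z hz => ?_
  · have : Continuous fun z : ℂ => (Gamma (z + n + 1))⁻¹ :=
      continuous_inv_Gamma.comp (f := fun z : ℂ => z + n + 1) (by fun_prop)
    fun_prop
  · have hz' : ‖z‖ ≤ |R| := (show ‖z‖ ≤ R by simpa using hz).trans (le_abs_self R)
    have hn1 : (n : ℂ) + 1 ≠ 0 := Nat.cast_add_one_ne_zero n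
    have h1 : ‖(n : ℂ) + 1‖ = (n : ℝ) + 1 := by
      have := Complex.norm_natCast (n + 1); push_cast at this; exact this
    have hnR : 2 * |R| ≤ n := (Nat.le_ceil _).trans (by exact_mod_cast hn)
    set w : ℂ := z / ((n : ℂ) + 1) with hw
    have hwn : ‖w‖ = ‖z‖ / ((n : ℝ) + 1) := by rw [hw, norm_div, h1]
    have hw2 : ‖w‖ ≤ 1 / 2 := by
      rw [hwn, div_le_iff₀ (by positivity)]; linarith
    have hzn : z + n + 1 ≠ 0 := by
      intro h
      have : z = -((n : ℂ) + 1) := by linear_combination h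
      rw [this, norm_neg, h1] at hz'
      linarith [abs_nonneg R]
    have hw0 : 1 + w = (z + n + 1) / ((n : ℂ) + 1) := by rw [hw]; field_simp; ring
    have e1 : ((n + 1).factorial : ℂ) * (Gamma (z + (n + 1 : ℕ) + 1))⁻¹ =
        (n.factorial : ℂ) * (Gamma (z + n + 1))⁻¹ * (1 + w)⁻¹ := by
      rw [Nat.factorial_succ, hw0, inv_div]
      push_cast
      rw [show z + ((n : ℂ) + 1) + 1 = (z + n + 1) + 1 by ring, Gamma_add_one _ hzn, mul_inv]
      field_simp
    have e2 : w.re = z.re / ((n : ℝ) + 1) := by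
      have : w = z / (((n : ℝ) + 1 : ℝ) : ℂ) := by rw [hw]; push_cast; rfl
      rw [this, Complex.div_ofReal_re]
    have e3 : 6 * ‖w‖ ^ 2 ≤ 6 * |R| ^ 2 / ((n : ℝ) + 1) ^ 2 := by
      rw [hwn, div_pow, mul_div_assoc]
      gcongr
    have e4 : Real.exp (z.re * (harmonic (n + 1) : ℝ)) =
        Real.exp (z.re * harmonic n) * Real.exp w.re := by
      rw [← Real.exp_add, harmonic_succ_real, e2]; congr 1; ring
    rw [e1, e4, norm_mul]
    calc _ = (‖(n.factorial : ℂ) * (Gamma (z + n + 1))⁻¹‖ * Real.exp (z.re * harmonic n)) *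
          (‖(1 + w)⁻¹‖ * Real.exp w.re) := by ring
      _ ≤ _ := by
        gcongr
        exact (norm_inv_one_add_mul_exp_re_le w hw2).trans (Real.exp_le_exp.2 e3)

/-! ### Summable majorants and holomorphy of the two series. -/

theorem exp_neg_mul_harmonic_le {σ : ℝ} (hσ : 0 ≤ σ) (n : ℕ) :
    Real.exp (-σ * harmonic n) ≤ ((n : ℝ) + 1) ^ (-σ) := by
  have h := log_add_one_le_harmonic n
  push_cast at h
  rw [Real.rpow_def_of_pos (by positivity)]
  apply Real.exp_le_exp.2
  nlinarith

theorem summable_nat_add_one_rpow {p : ℝ} (hp : p < -1) :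
    Summable fun n : ℕ => ((n : ℝ) + 1) ^ p := by
  have := (summable_nat_add_iff 1).2 (Real.summable_nat_rpow.2 hp)
  simpa using this

/-- The terms of `∑_{m ≥ 1} (a)ₘ (b)ₘ / (m · m!²)`, indexed by `n = m - 1`. -/
noncomputable def upperTerm (a b : ℂ) (n : ℕ) : ℂ :=
  ((ascPochhammer ℂ (n + 1)).eval a / (n + 1).factorial) *
    ((ascPochhammer ℂ (n + 1)).eval b / (n + 1).factorial) / ((n : ℂ) + 1)

/-- The terms of the everywhere regular series `∑ (a)ₙ³ / (n! Γ(a + n + 1) Γ(a - b + n + 1))`. -/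
noncomputable def lowerTerm (a b : ℂ) (n : ℕ) : ℂ :=
  ((ascPochhammer ℂ n).eval a / n.factorial) ^ 3 *
    (n.factorial * (Gamma (a + n + 1))⁻¹) * (n.factorial * (Gamma (a - b + n + 1))⁻¹)

theorem exists_summable_bound_upperTerm (R : ℝ) {s : ℝ} (hs : s < 2) :
    ∃ v : ℕ → ℝ, Summable v ∧ ∀ n : ℕ, ∀ a b : ℂ, ‖a‖ ≤ R → ‖b‖ ≤ R → (a + b).re ≤ s →
      ‖upperTerm a b n‖ ≤ v n := by
  obtain ⟨C, hC0, hC⟩ := exists_norm_ascPochhammer_div_factorial_le R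
  refine ⟨fun n => C ^ 2 * ((n : ℝ) + 1) ^ (s - 3),
    (summable_nat_add_one_rpow (by linarith)).mul_left _, fun n a b ha hb hab => ?_⟩
  have h1 : ‖(n : ℂ) + 1‖ = (n : ℝ) + 1 := by
    have := Complex.norm_natCast (n + 1); push_cast at this; exact this
  have hn : (0 : ℝ) < (n : ℝ) + 1 := by positivity
  have hH : (0 : ℝ) ≤ harmonic (n + 1) := by
    have := log_add_one_le_harmonic (n + 1)
    exact (Real.log_nonneg (by push_cast; linarith)).trans this
  rw [upperTerm, norm_div, norm_mul, h1, div_le_iff₀ hn]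
  rw [add_re] at hab
  calc _ ≤ (C * Real.exp ((a.re - 1) * harmonic (n + 1))) *
        (C * Real.exp ((b.re - 1) * harmonic (n + 1))) := by
        gcongr
        · exact hC _ a ha
        · exact hC _ b hb
    _ = C ^ 2 * Real.exp ((a.re + b.re - 2) * harmonic (n + 1)) := by
        rw [show (a.re + b.re - 2) * (harmonic (n + 1) : ℝ) = (a.re - 1) * harmonic (n + 1) +
          (b.re - 1) * harmonic (n + 1) by ring, Real.exp_add]; ring
    -- Passing to `s < 2` makes the exponent negative, so the lower bound `log (n + 1) ≤ harmonic n`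
    -- suffices.
    _ ≤ C ^ 2 * Real.exp (-(2 - s) * harmonic (n + 1)) := by
        gcongr; linarith
    _ ≤ C ^ 2 * ((n : ℝ) + 1) ^ (s - 2) := by
        gcongr
        refine (exp_neg_mul_harmonic_le (by linarith) (n + 1)).trans ?_
        rw [neg_sub]
        apply Real.rpow_le_rpow_of_nonpos hn (by push_cast; linarith) (by linarith)
    _ = _ := by
        rw [mul_assoc, ← Real.rpow_add_one hn.ne']; congr 2; ring

theorem exists_summable_bound_lowerTerm (R : ℝ) {s : ℝ} (hs : s < 2) :
    ∃ v : ℕ → ℝ, Summable v ∧ ∀ n : ℕ, ∀ a b : ℂ, ‖a‖ ≤ R → ‖b‖ ≤ R → (a + b).re ≤ s →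
      ‖lowerTerm a b n‖ ≤ v n := by
  obtain ⟨C, hC0, hC⟩ := exists_norm_ascPochhammer_div_factorial_le R
  -- The radius `2 * R` covers `a - b` as well as `a`.
  obtain ⟨D, hD0, hD⟩ := exists_norm_factorial_div_Gamma_le (2 * R)
  refine ⟨fun n => C ^ 3 * D ^ 2 * ((n : ℝ) + 1) ^ (s - 3),
    (summable_nat_add_one_rpow (by linarith)).mul_left _, fun n a b ha hb hab => ?_⟩
  have hR : 0 ≤ R := (norm_nonneg a).trans ha
  have hH : (0 : ℝ) ≤ harmonic n := by
    have := log_add_one_le_harmonic n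
    exact (Real.log_nonneg (by push_cast; linarith [n.cast_nonneg (α := ℝ)])).trans this
  rw [lowerTerm, norm_mul, norm_mul, norm_pow]
  rw [add_re] at hab
  calc _ ≤ (C * Real.exp ((a.re - 1) * harmonic n)) ^ 3 *
        (D * Real.exp (-a.re * harmonic n)) * (D * Real.exp (-(a - b).re * harmonic n)) := by
        gcongr
        · exact hC _ a ha
        · exact hD _ a (by linarith)
        · exact hD _ (a - b) ((norm_sub_le _ _).trans (by linarith))
    _ = C ^ 3 * D ^ 2 * Real.exp ((a.re + b.re - 3) * harmonic n) := by
        rw [show (a.re + b.re - 3) * (harmonic n : ℝ) = (3 : ℕ) * ((a.re - 1) * harmonic n) +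
          (-a.re * harmonic n) + (-(a - b).re * harmonic n) by rw [sub_re]; push_cast; ring,
          Real.exp_add, Real.exp_add, Real.exp_nat_mul]; ring
    _ ≤ C ^ 3 * D ^ 2 * Real.exp (-(3 - s) * harmonic n) := by
        gcongr; linarith
    _ ≤ _ := by
        have := exp_neg_mul_harmonic_le (σ := 3 - s) (by linarith) n
        rw [neg_sub 3 s] at this ⊢
        exact mul_le_mul_of_nonneg_left this (by positivity)

theorem summable_upperTerm {a b : ℂ} (h : (a + b).re < 2) : Summable (upperTerm a b) := by
  obtain ⟨v, hv, H⟩ := exists_summable_bound_upperTerm (max ‖a‖ ‖b‖) h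
  exact hv.of_norm_bounded fun n => H n a b (le_max_left _ _) (le_max_right _ _) le_rfl

theorem summable_lowerTerm {a b : ℂ} (h : (a + b).re < 2) : Summable (lowerTerm a b) := by
  obtain ⟨v, hv, H⟩ := exists_summable_bound_lowerTerm (max ‖a‖ ‖b‖) h
  exact hv.of_norm_bounded fun n => H n a b (le_max_left _ _) (le_max_right _ _) le_rfl

/-- A series of functions of two variables dominated uniformly on bounded sets with
`re (a + b) ≤ s < 2` is differentiable along differentiable curves. -/
theorem differentiableAt_tsum_of_bound {F : ℂ → ℂ → ℕ → ℂ}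
    (hF : ∀ R s : ℝ, s < 2 → ∃ v : ℕ → ℝ, Summable v ∧ ∀ n : ℕ, ∀ a b : ℂ, ‖a‖ ≤ R → ‖b‖ ≤ R →
      (a + b).re ≤ s → ‖F a b n‖ ≤ v n)
    {f g : ℂ → ℂ} (hf : Continuous f) (hg : Continuous g)
    (hd : ∀ n, Differentiable ℂ fun z => F (f z) (g z) n) {z : ℂ} (hz : (f z + g z).re < 2) :
    DifferentiableAt ℂ (fun z => ∑' n, F (f z) (g z) n) z := by
  obtain ⟨s, hs1, hs2⟩ := exists_between hz
  obtain ⟨v, hv, H⟩ := hF (max (‖f z‖ + 1) (‖g z‖ + 1)) s hs2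
  set V : Set ℂ := {w | ‖f w‖ < ‖f z‖ + 1} ∩ {w | ‖g w‖ < ‖g z‖ + 1} ∩ {w | (f w + g w).re < s}
  have hV : IsOpen V :=
    ((isOpen_lt hf.norm continuous_const).inter (isOpen_lt hg.norm continuous_const)).inter
      (isOpen_lt (continuous_re.comp (hf.add hg)) continuous_const)
  have hzV : z ∈ V := by simp [V]; simpa using hs1
  refine (differentiableOn_tsum_of_summable_norm hv (fun n => (hd n).differentiableOn) hV
    fun n w hw => H n _ _ ?_ ?_ ?_).differentiableAt (hV.mem_nhds hzV)
  · exact hw.1.1.le.trans (le_max_left _ _)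
  · exact hw.1.2.le.trans (le_max_right _ _)
  · exact hw.2.le

theorem differentiableAt_tsum_upperTerm {f g : ℂ → ℂ} (hf : Differentiable ℂ f)
    (hg : Differentiable ℂ g) {z : ℂ} (hz : (f z + g z).re < 2) :
    DifferentiableAt ℂ (fun z => ∑' n, upperTerm (f z) (g z) n) z := by
  refine differentiableAt_tsum_of_bound (fun R s hs => exists_summable_bound_upperTerm R hs)
    hf.continuous hg.continuous (fun n => ?_) hz
  have h := (ascPochhammer ℂ (n + 1)).differentiable
  have h1 := h.comp hf
  have h2 := h.comp hg
  exact ((h1.div_const _).mul (h2.div_const _)).div_const _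

theorem differentiableAt_tsum_lowerTerm {f g : ℂ → ℂ} (hf : Differentiable ℂ f)
    (hg : Differentiable ℂ g) {z : ℂ} (hz : (f z + g z).re < 2) :
    DifferentiableAt ℂ (fun z => ∑' n, lowerTerm (f z) (g z) n) z := by
  refine differentiableAt_tsum_of_bound (fun R s hs => exists_summable_bound_lowerTerm R hs)
    hf.continuous hg.continuous (fun n => ?_) hz
  have h1 := ((ascPochhammer ℂ n).differentiable.comp hf).div_const (n.factorial : ℂ)
  have h2 := differentiable_one_div_Gamma.comp ((hf.add_const (n : ℂ)).add_const (1 : ℂ))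
  have h3 := differentiable_one_div_Gamma.comp
    (((hf.sub hg).add_const (n : ℂ)).add_const (1 : ℂ))
  exact ((h1.pow 3).mul (h2.const_mul _)).mul (h3.const_mul _)

/-! ### Products of beta integrals as sums of two series. -/

section BetaSeries

open MeasureTheory Set ProbabilityTheory

theorem hasSum_ascPochhammer_mul_pow (β : ℝ) {s : ℝ} (hs : |s| < 1) :
    HasSum (fun m : ℕ => (ascPochhammer ℝ m).eval β / m.factorial * s ^ m) ((1 - s) ^ (-β)) := by
  have h := (Real.one_div_one_sub_rpow_hasFPowerSeriesOnBall_zero β).hasSum (y := s)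
    (by simpa [enorm_eq_nnnorm, ← NNReal.coe_lt_one] using hs)
  have hpos : 0 < 1 - s := by linarith [le_abs_self s]
  rw [Real.rpow_neg hpos.le]
  simp only [zero_add, one_div] at h
  convert! h using 2 with m
  have hf : (m.factorial : ℝ) ≠ 0 := by exact_mod_cast m.factorial_ne_zero
  have := Ring.factorial_nsmul_multichoose_eq_ascPochhammer β m
  rw [Polynomial.ascPochhammer_smeval_eq_eval] at this
  rw [FormalMultilinearSeries.ofScalars_apply_eq, ← this, Ring.choose, smul_eq_mul, nsmul_eq_mul,
    mul_div_cancel_left₀ _ hf]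
  congr 3; ring

/-- Tonelli on the two sides of the diagonal, which is a null set. With `ENNReal` values no
integrability is needed. -/
theorem lintegral_mul_lintegral_eq_add {f g : ℝ → ENNReal} (hf : Measurable f)
    (hg : Measurable g) :
    (∫⁻ t, f t) * ∫⁻ s, g s =
      (∫⁻ t, f t * ∫⁻ s in Iio t, g s) + ∫⁻ s, g s * ∫⁻ t in Iio s, f t := by
  have hmeas : Measurable fun t => f t * ∫⁻ s in Iio t, g s := by
    refine hf.mul (Monotone.measurable fun x y hxy => ?_)
    exact lintegral_mono_set (Iio_subset_Iio hxy)
  have h1 : ∀ t, f t * ∫⁻ s, g s = (f t * ∫⁻ s in Iio t, g s) + f t * ∫⁻ s in Ici t, g s := by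
    intro t
    rw [← mul_add, ← lintegral_add_compl g (measurableSet_Iio (a := t)), compl_Iio]
  rw [← lintegral_mul_const _ hf]
  simp_rw [h1]
  rw [lintegral_add_left hmeas]
  congr 1
  have h2 : ∀ t, f t * ∫⁻ s in Ici t, g s =
      ∫⁻ s, {x : ℝ × ℝ | x.1 ≤ x.2}.indicator (fun x => f x.1 * g x.2) (t, s) := by
    intro t
    rw [← lintegral_const_mul _ hg, ← lintegral_indicator measurableSet_Ici]
    rfl
  have h3 : ∀ s, g s * ∫⁻ t in Iio s, f t =
      ∫⁻ t, {x : ℝ × ℝ | x.1 ≤ x.2}.indicator (fun x => f x.1 * g x.2) (t, s) := by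
    intro s
    rw [setLIntegral_congr Iio_ae_eq_Iic, ← lintegral_const_mul _ hf,
      ← lintegral_indicator measurableSet_Iic]
    simp_rw [mul_comm (g s)]
    rfl
  simp_rw [h2, h3]
  rw [lintegral_lintegral_swap]
  refine Measurable.aemeasurable ?_
  refine Measurable.indicator ?_ (measurableSet_le measurable_fst measurable_snd)
  exact (hf.comp measurable_fst).mul (hg.comp measurable_snd)

/-- The beta kernel `t ^ (p - 1) * (1 - t) ^ (-α)` on `(0, 1)`, extended by zero. -/
noncomputable def betaKernel (p α : ℝ) : ℝ → ENNReal :=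
  (Ioo (0 : ℝ) 1).indicator fun t => ENNReal.ofReal (t ^ (p - 1) * (1 - t) ^ (-α))

theorem measurable_betaKernel (p α : ℝ) : Measurable (betaKernel p α) :=
  Measurable.indicator (by fun_prop) measurableSet_Ioo

theorem lintegral_betaKernel {p α : ℝ} (hp : 0 < p) (hα : α < 1) :
    ∫⁻ t, betaKernel p α t = ENNReal.ofReal (beta p (1 - α)) := by
  have hq : 0 < 1 - α := by linarith
  have hb := beta_pos hp hq
  have h := lintegral_betaPDF_eq_one hp hq
  rw [lintegral_betaPDF] at h
  rw [betaKernel, lintegral_indicator measurableSet_Ioo,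
    ← mul_one (ENNReal.ofReal (beta p (1 - α))), ← h, ← lintegral_const_mul _ (by fun_prop)]
  refine setLIntegral_congr_fun measurableSet_Ioo fun t _ => ?_
  rw [← ENNReal.ofReal_mul hb.le]
  congr 1
  rw [show 1 - α - 1 = -α by ring]
  field_simp

theorem ascPochhammer_eval_nonneg {β : ℝ} (hβ : 0 < β) (m : ℕ) :
    0 ≤ (ascPochhammer ℝ m).eval β := (ascPochhammer_pos m β hβ).le

/-- Binomial expansion of `(1 - s) ^ (-β)`, integrated termwise; `0 < β` makes every coefficient
nonnegative. -/
theorem setLIntegral_betaKernel_Iio {q β t : ℝ} (hq : 0 < q) (hβ : 0 < β) (ht : t ∈ Ioo (0 : ℝ) 1) :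
    ∫⁻ s in Iio t, betaKernel q β s = ∑' m : ℕ, ENNReal.ofReal
      ((ascPochhammer ℝ m).eval β / m.factorial / (q + m) * t ^ (q + m)) := by
  have h1 : ∫⁻ s in Iio t, betaKernel q β s = ∫⁻ s in Ioo 0 t, ∑' m : ℕ, ENNReal.ofReal
      ((ascPochhammer ℝ m).eval β / m.factorial * s ^ (q + m - 1)) := by
    rw [betaKernel, setLIntegral_indicator measurableSet_Ioo]
    have : Ioo (0 : ℝ) 1 ∩ Iio t = Ioo 0 t := by
      ext x; simp only [mem_inter_iff, mem_Ioo, mem_Iio]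
      exact ⟨fun h => ⟨h.1.1, h.2⟩, fun h => ⟨⟨h.1, h.2.trans ht.2⟩, h.2⟩⟩
    rw [this]
    refine setLIntegral_congr_fun measurableSet_Ioo fun s hs => ?_
    have hs1 : |s| < 1 := by rw [abs_of_pos hs.1]; exact hs.2.trans ht.2
    have hsum := (hasSum_ascPochhammer_mul_pow β hs1).mul_left (s ^ (q - 1))
    rw [← hsum.tsum_eq, ENNReal.ofReal_tsum_of_nonneg (fun m => ?_) hsum.summable]
    · refine tsum_congr fun m => ?_
      rw [show q + m - 1 = (q - 1) + m by ring, Real.rpow_add_natCast hs.1.ne']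
      congr 1; ring
    · have := ascPochhammer_eval_nonneg hβ m
      have := hs.1
      positivity
  rw [h1, lintegral_tsum fun m => by fun_prop]
  refine tsum_congr fun m => ?_
  have hqm : 0 < q + m := by positivity
  have hP := ascPochhammer_eval_nonneg hβ m
  rw [← ofReal_integral_eq_lintegral_ofReal]
  · congr 1
    rw [integral_const_mul, ← integral_Ioc_eq_integral_Ioo, ← intervalIntegral.integral_of_le ht.1.le,
      integral_rpow (Or.inl (by linarith))]
    rw [sub_add_cancel, Real.zero_rpow hqm.ne', sub_zero]
    ring
  · refine Integrable.const_mul ?_ _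
    have := intervalIntegral.intervalIntegrable_rpow' (a := 0) (b := t) (r := q + m - 1) (by linarith)
    rw [intervalIntegrable_iff_integrableOn_Ioo_of_le ht.1.le] at this
    exact this
  · refine ae_restrict_of_forall_mem measurableSet_Ioo fun s hs => ?_
    have := hs.1
    simp only [Pi.zero_apply]
    positivity

theorem lintegral_betaKernel_mul_setLIntegral {p q α β : ℝ} (hp : 0 < p) (hq : 0 < q)
    (hα : α < 1) (hβ : 0 < β) :
    ∫⁻ t, betaKernel p α t * ∫⁻ s in Iio t, betaKernel q β s = ∑' m : ℕ, ENNReal.ofReal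
      ((ascPochhammer ℝ m).eval β / m.factorial / (q + m) * beta (p + q + m) (1 - α)) := by
  have h1 : ∀ t, betaKernel p α t * ∫⁻ s in Iio t, betaKernel q β s = ∑' m : ℕ,
      ENNReal.ofReal ((ascPochhammer ℝ m).eval β / m.factorial / (q + m)) *
        betaKernel (p + q + m) α t := by
    intro t
    by_cases ht : t ∈ Ioo (0 : ℝ) 1
    · rw [setLIntegral_betaKernel_Iio hq hβ ht, ← ENNReal.tsum_mul_left]
      refine tsum_congr fun m => ?_
      have hP := ascPochhammer_eval_nonneg hβ m
      have h0 := ht.1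
      have h2 : 0 < 1 - t := by linarith [ht.2]
      simp only [betaKernel, indicator_of_mem ht]
      rw [← ENNReal.ofReal_mul (by positivity), ← ENNReal.ofReal_mul (by positivity)]
      congr 1
      rw [show p + q + m - 1 = (p - 1) + (q + m) by ring, Real.rpow_add h0 (p - 1) (q + m)]
      ring
    · simp [betaKernel, indicator_of_notMem ht]
  simp_rw [h1]
  rw [lintegral_tsum fun m => ((measurable_betaKernel _ _).const_mul _).aemeasurable]
  refine tsum_congr fun m => ?_
  have hP := ascPochhammer_eval_nonneg hβ m
  rw [lintegral_const_mul _ (measurable_betaKernel _ _), lintegral_betaKernel (by positivity) hα,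
    ← ENNReal.ofReal_mul (by positivity)]

theorem summable_and_tsum_ofReal_eq {f : ℕ → ℝ} (hf : ∀ n, 0 ≤ f n)
    (h : ∑' n, ENNReal.ofReal (f n) ≠ ⊤) :
    Summable f ∧ ∑' n, ENNReal.ofReal (f n) = ENNReal.ofReal (∑' n, f n) := by
  have hs : Summable f := by
    have := ENNReal.summable_toReal h
    simpa only [ENNReal.toReal_ofReal (hf _)] using this
  exact ⟨hs, (ENNReal.ofReal_tsum_of_nonneg hf hs).symm⟩

/-- Summability comes for free: two nonnegative series whose sum is a finite product must both
converge. -/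
theorem beta_mul_beta_eq_tsum_add_tsum {p q α β : ℝ} (hp : 0 < p) (hq : 0 < q)
    (hα : 0 < α) (hα1 : α < 1) (hβ : 0 < β) (hβ1 : β < 1) :
    Summable (fun m : ℕ => (ascPochhammer ℝ m).eval β / m.factorial / (q + m) *
      beta (p + q + m) (1 - α)) ∧
    Summable (fun m : ℕ => (ascPochhammer ℝ m).eval α / m.factorial / (p + m) *
      beta (p + q + m) (1 - β)) ∧
    beta p (1 - α) * beta q (1 - β) =
      (∑' m : ℕ, (ascPochhammer ℝ m).eval β / m.factorial / (q + m) *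
        beta (p + q + m) (1 - α)) +
      ∑' m : ℕ, (ascPochhammer ℝ m).eval α / m.factorial / (p + m) *
        beta (p + q + m) (1 - β) := by
  have key := lintegral_mul_lintegral_eq_add (measurable_betaKernel p α) (measurable_betaKernel q β)
  rw [lintegral_betaKernel hp hα1, lintegral_betaKernel hq hβ1,
    lintegral_betaKernel_mul_setLIntegral hp hq hα1 hβ,
    lintegral_betaKernel_mul_setLIntegral hq hp hβ1 hα, add_comm q p,
    ← ENNReal.ofReal_mul (beta_pos hp (by linarith)).le] at key
  have hne : ∀ x y z : ENNReal, z ≠ ⊤ → z = x + y → x ≠ ⊤ ∧ y ≠ ⊤ := fun x y z hz h =>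
    ENNReal.add_ne_top.1 (h ▸ hz)
  obtain ⟨hx, hy⟩ := hne _ _ _ ENNReal.ofReal_ne_top key
  have n1 : ∀ m : ℕ, 0 ≤ (ascPochhammer ℝ m).eval β / m.factorial / (q + m) *
      beta (p + q + m) (1 - α) := fun m => by
    have := ascPochhammer_eval_nonneg hβ m
    have := (beta_pos (α := p + q + m) (β := 1 - α) (by positivity) (by linarith)).le
    positivity
  have n2 : ∀ m : ℕ, 0 ≤ (ascPochhammer ℝ m).eval α / m.factorial / (p + m) *
      beta (p + q + m) (1 - β) := fun m => by
    have := ascPochhammer_eval_nonneg hα m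
    have := (beta_pos (α := p + q + m) (β := 1 - β) (by positivity) (by linarith)).le
    positivity
  obtain ⟨s1, e1⟩ := summable_and_tsum_ofReal_eq n1 hx
  obtain ⟨s2, e2⟩ := summable_and_tsum_ofReal_eq n2 hy
  refine ⟨s1, s2, ?_⟩
  rw [e1, e2, ← ENNReal.ofReal_add (tsum_nonneg n1) (tsum_nonneg n2)] at key
  refine (ENNReal.ofReal_eq_ofReal_iff ?_ ?_).1 key
  · exact (mul_pos (beta_pos hp (by linarith)) (beta_pos hq (by linarith))).le
  · exact add_nonneg (tsum_nonneg n1) (tsum_nonneg n2)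

theorem Real.Gamma_add_natCast_eq {a : ℝ} (ha : 0 < a) (m : ℕ) :
    Real.Gamma (a + m) = Real.Gamma a * (ascPochhammer ℝ m).eval a := by
  induction m with
  | zero => simp
  | succ m ih =>
    rw [ascPochhammer_succ_eval, ← mul_assoc, ← ih]
    push_cast
    rw [← add_assoc, Real.Gamma_add_one (by positivity)]
    ring

end BetaSeries

/-! ### The identity for real parameters in `(0, 1)`. -/

/-- Take `p = a - ε`, `q = ε`, `α = a`, `β = b` in the beta identity. Since `p + q = a`, the factor
`B(a + m, 1 - a)` collapses to `Γ(a + m) Γ(1 - a) / m!`. -/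
theorem Gamma_partial_fraction {a b ε : ℝ} (hε : 0 < ε) (hεa : ε < a) (ha1 : a < 1) (hb : 0 < b)
    (hb1 : b < 1) :
    Summable (fun m : ℕ => (ascPochhammer ℝ m).eval a / m.factorial *
      ((ascPochhammer ℝ m).eval b / m.factorial) / (m + ε)) ∧
    Summable (fun n : ℕ => ((ascPochhammer ℝ n).eval a / n.factorial) ^ 2 *
      (n.factorial / Real.Gamma (a - b + n + 1)) / (a + n - ε)) ∧
    Real.Gamma (a - ε) * Real.Gamma ε * Real.Gamma (1 - b) /
        (Real.Gamma a * Real.Gamma (1 - ε) * Real.Gamma (1 - b + ε)) =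
      (∑' m : ℕ, (ascPochhammer ℝ m).eval a / m.factorial *
        ((ascPochhammer ℝ m).eval b / m.factorial) / (m + ε)) +
      Real.Gamma (1 - b) / Real.Gamma (1 - a) *
        ∑' n : ℕ, ((ascPochhammer ℝ n).eval a / n.factorial) ^ 2 *
          (n.factorial / Real.Gamma (a - b + n + 1)) / (a + n - ε) := by
  have ha : 0 < a := hε.trans hεa
  have gpos : ∀ {x : ℝ}, 0 < x → Real.Gamma x ≠ 0 := fun h => (Real.Gamma_pos_of_pos h).ne'
  have g1 := gpos ha
  have g2 := gpos (sub_pos.2 ha1)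
  have g3 := gpos (sub_pos.2 hb1)
  have g4 := gpos (sub_pos.2 (hεa.trans ha1))
  have g5 := gpos (add_pos (sub_pos.2 hb1) hε)
  obtain ⟨s1, s2, e⟩ := beta_mul_beta_eq_tsum_add_tsum (sub_pos.2 hεa) hε ha ha1 hb hb1
  have t1 : (fun m : ℕ => (ascPochhammer ℝ m).eval b / m.factorial / (ε + m) *
      ProbabilityTheory.beta (a - ε + ε + m) (1 - a)) = fun m : ℕ =>
      (Real.Gamma a * Real.Gamma (1 - a)) * ((ascPochhammer ℝ m).eval a / m.factorial *
        ((ascPochhammer ℝ m).eval b / m.factorial) / (m + ε)) := by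
    funext m
    have hf : (m.factorial : ℝ) ≠ 0 := by exact_mod_cast m.factorial_ne_zero
    rw [ProbabilityTheory.beta, show a - ε + ε + m = a + m by ring,
      show a + m + (1 - a) = (m : ℝ) + 1 by ring, Real.Gamma_add_natCast_eq ha,
      Real.Gamma_nat_eq_factorial, add_comm ε]
    field_simp
  have t2 : (fun m : ℕ => (ascPochhammer ℝ m).eval a / m.factorial / (a - ε + m) *
      ProbabilityTheory.beta (a - ε + ε + m) (1 - b)) = fun m : ℕ =>
      (Real.Gamma a * Real.Gamma (1 - b)) * (((ascPochhammer ℝ m).eval a / m.factorial) ^ 2 *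
        (m.factorial / Real.Gamma (a - b + m + 1)) / (a + m - ε)) := by
    funext m
    have hf : (m.factorial : ℝ) ≠ 0 := by exact_mod_cast m.factorial_ne_zero
    rw [ProbabilityTheory.beta, show a - ε + ε + m = a + m by ring,
      show a + m + (1 - b) = a - b + (m : ℝ) + 1 by ring, Real.Gamma_add_natCast_eq ha,
      show a - ε + m = a + m - ε by ring]
    field_simp
  rw [t1, summable_mul_left_iff (mul_ne_zero g1 g2)] at s1
  rw [t2, summable_mul_left_iff (mul_ne_zero g1 g3)] at s2
  rw [t1, t2, tsum_mul_left, tsum_mul_left, ProbabilityTheory.beta, ProbabilityTheory.beta,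
    show a - ε + (1 - a) = 1 - ε by ring, show ε + (1 - b) = 1 - b + ε by ring] at e
  refine ⟨s1, s2, ?_⟩
  have := congrArg (fun x => x / (Real.Gamma a * Real.Gamma (1 - a))) e
  simp only [add_div] at this
  rw [mul_div_cancel_left₀ _ (mul_ne_zero g1 g2)] at this
  convert this using 1
  · field_simp
  · congr 1; field_simp

/-- The difference of the two sides of `tsum_upperTerm_eq`, multiplied by `1 / (Γ(a) Γ(1 - b))`
so that it is holomorphic in each variable on `re (a + b) < 2`. -/
noncomputable def regularizedDefect (a b : ℂ) : ℂ :=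
  (∑' n, upperTerm a b n + 2 * Real.eulerMascheroniConstant) * ((Gamma a)⁻¹ * (Gamma (1 - b))⁻¹) -
    deriv (fun z : ℂ => (Gamma z)⁻¹) a * (Gamma (1 - b))⁻¹ -
    (Gamma a)⁻¹ * deriv (fun z : ℂ => (Gamma z)⁻¹) (1 - b) +
    (Gamma (1 - a))⁻¹ * ∑' n, lowerTerm a b n

theorem hasDerivAt_Gamma_digamma {z : ℂ} (hz : ∀ m : ℕ, z ≠ -m) :
    HasDerivAt Gamma (Gamma z * digamma z) z := by
  have := (differentiableAt_Gamma z hz).hasDerivAt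
  rwa [digamma_def, logDeriv_apply, mul_div_cancel₀ _ (Gamma_ne_zero hz)]

theorem deriv_inv_Gamma {z : ℂ} (hz : ∀ m : ℕ, z ≠ -m) :
    deriv (fun z : ℂ => (Gamma z)⁻¹) z = -digamma z * (Gamma z)⁻¹ := by
  have h := Gamma_ne_zero hz
  rw [((hasDerivAt_Gamma_digamma hz).fun_inv h).deriv]
  field_simp

theorem ofReal_ascPochhammer_eval (a : ℝ) (n : ℕ) :
    (((ascPochhammer ℝ n).eval a : ℝ) : ℂ) = (ascPochhammer ℂ n).eval (a : ℂ) := by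
  rw [← ascPochhammer_map ofRealHom n]
  exact (Polynomial.eval_map_apply ofRealHom a).symm

theorem ne_neg_nat_of_re_pos {z : ℂ} (hz : 0 < z.re) (m : ℕ) : z ≠ -m := by
  rintro rfl
  simp at hz
  linarith [m.cast_nonneg (α := ℝ)]

/-- As `Γ(1 + ε) = ε Γ(ε)`, this is `ε` times the left side of `Gamma_partial_fraction`. It equals
`1` at `0`, so its difference quotient there is that left side minus `1 / ε`. -/
theorem hasDerivAt_Gamma_ratio {a b : ℝ} (ha : 0 < a) (hb1 : b < 1) :
    HasDerivAt (fun ε : ℂ => Gamma (a - ε) * Gamma (1 + ε) * Gamma (1 - b) /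
      (Gamma a * Gamma (1 - ε) * Gamma (1 - b + ε)))
      (-2 * Real.eulerMascheroniConstant - digamma a - digamma (1 - b)) 0 := by
  have hA : ∀ m : ℕ, (a : ℂ) ≠ -m := ne_neg_nat_of_re_pos (by simpa using ha)
  have hB : ∀ m : ℕ, (1 - b : ℂ) ≠ -m := ne_neg_nat_of_re_pos (by simpa using hb1)
  have h1 : ∀ m : ℕ, (1 : ℂ) ≠ -m := ne_neg_nat_of_re_pos (by simp)
  have gA := Gamma_ne_zero hA
  have gB := Gamma_ne_zero hB
  have d1 : HasDerivAt (fun ε : ℂ => Gamma (a - ε)) (-(Gamma a * digamma a)) 0 := by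
    have := (show HasDerivAt Gamma (Gamma a * digamma a) ((a : ℂ) - 0) by
      rw [sub_zero]; exact hasDerivAt_Gamma_digamma hA).comp_const_sub (a : ℂ) 0
    exact this
  have d2 : HasDerivAt (fun ε : ℂ => Gamma (1 + ε)) (Gamma 1 * digamma 1) 0 := by
    exact (show HasDerivAt Gamma (Gamma 1 * digamma 1) ((1 : ℂ) + 0) by
      rw [add_zero]; exact hasDerivAt_Gamma_digamma h1).comp_const_add (1 : ℂ) 0
  have d3 : HasDerivAt (fun ε : ℂ => Gamma (1 - ε)) (-(Gamma 1 * digamma 1)) 0 := by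
    exact (show HasDerivAt Gamma (Gamma 1 * digamma 1) ((1 : ℂ) - 0) by
      rw [sub_zero]; exact hasDerivAt_Gamma_digamma h1).comp_const_sub (1 : ℂ) 0
  have d4 : HasDerivAt (fun ε : ℂ => Gamma (1 - b + ε)) (Gamma (1 - b) * digamma (1 - b)) 0 := by
    exact (show HasDerivAt Gamma (Gamma (1 - b) * digamma (1 - b)) ((1 - b : ℂ) + 0) by
      rw [add_zero]; exact hasDerivAt_Gamma_digamma hB).comp_const_add (1 - b : ℂ) 0
  have hne : Gamma (a : ℂ) * Gamma (1 - 0) * Gamma (1 - b + 0) ≠ 0 := by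
    simp only [sub_zero, add_zero, Gamma_one, mul_one]
    exact mul_ne_zero gA gB
  have := ((d1.mul d2).mul_const (Gamma (1 - b))).div ((d3.const_mul (Gamma a)).mul d4) hne
  refine this.congr_deriv ?_
  simp only [Pi.mul_apply, sub_zero, add_zero, Gamma_one, mul_one, one_mul, digamma_one]
  field_simp
  ring

theorem upperTerm_ofReal (a b : ℝ) (n : ℕ) : upperTerm a b n =
    (((ascPochhammer ℝ (n + 1)).eval a / (n + 1).factorial *
      ((ascPochhammer ℝ (n + 1)).eval b / (n + 1).factorial) / ((n : ℝ) + 1) : ℝ) : ℂ) := by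
  rw [upperTerm]
  push_cast [ofReal_ascPochhammer_eval]
  rfl

/-- One factor `(a)ₙ` cancels against `Γ(a + n + 1) = (a + n) Γ(a) (a)ₙ`, giving the shape of the
second series at `ε = 0`. -/
theorem lowerTerm_eq {a : ℂ} (ha : ∀ m : ℕ, a ≠ -m) (b : ℂ) (n : ℕ) :
    lowerTerm a b n = (Gamma a)⁻¹ * (((ascPochhammer ℂ n).eval a / n.factorial) ^ 2 *
      (n.factorial * (Gamma (a - b + n + 1))⁻¹) / (a + n)) := by
  have hn : a + n ≠ 0 := fun h => ha n (by linear_combination h)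
  have hf : (n.factorial : ℂ) ≠ 0 := by exact_mod_cast n.factorial_ne_zero
  have hG := Gamma_ne_zero ha
  have hp : (ascPochhammer ℂ n).eval a ≠ 0 := by
    rw [Ne, ascPochhammer_eval_eq_zero_iff]
    rintro ⟨k, -, hk⟩
    exact ha k (by rw [hk]; simp)
  have e : Gamma (a + n + 1) = (a + n) * (Gamma a * (ascPochhammer ℂ n).eval a) := by
    rw [Gamma_add_one _ hn, ← Gamma_add_nat_div_Gamma_eq a ha, mul_div_cancel₀ _ hG]
  rw [lowerTerm, e]
  field_simp

theorem tsum_upperTerm_eq_of_mem_Ioo {a b : ℝ} (ha : 0 < a) (ha1 : a < 1) (hb : 0 < b)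
    (hb1 : b < 1) :
    ∑' n, upperTerm a b n = -2 * Real.eulerMascheroniConstant - digamma a - digamma (1 - b) -
      Gamma (1 - b) / Gamma (1 - a) * ∑' n : ℕ,
        ((ascPochhammer ℂ n).eval (a : ℂ) / n.factorial) ^ 2 *
          (n.factorial * (Gamma ((a : ℂ) - b + n + 1))⁻¹) / (a + n) := by
  set P : ℝ → ℕ → ℝ := fun x n => (ascPochhammer ℝ n).eval x / n.factorial with hP
  have hP0 : ∀ {x : ℝ}, 0 < x → ∀ n, 0 ≤ P x n := fun hx n => by
    have := ascPochhammer_eval_nonneg hx n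
    positivity
  set L : ℕ → ℝ := fun n => P a n ^ 2 * (n.factorial / Real.Gamma (a - b + n + 1)) with hL
  have hL0 : ∀ n, 0 ≤ L n := fun n => by
    have h1 : 0 < a - b + n + 1 := by linarith [n.cast_nonneg (α := ℝ)]
    have := Real.Gamma_pos_of_pos h1
    positivity
  set U : ℕ → ℝ := fun n => P a (n + 1) * P b (n + 1) with hU
  have hU0 : ∀ n, 0 ≤ U n := fun n => mul_nonneg (hP0 ha _) (hP0 hb _)
  have hmem : ∀ᶠ ε : ℝ in 𝓝[>] 0, 0 < ε ∧ ε < a / 2 :=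
    (eventually_mem_nhdsWithin).and
      (mem_nhdsWithin_of_mem_nhds (Iio_mem_nhds (by linarith)))
  have hUs : Summable fun n => U n / ((n : ℝ) + 1) := by
    have := summable_upperTerm (a := a) (b := b) (by simp; linarith)
    rw [funext (upperTerm_ofReal a b)] at this
    exact Complex.summable_ofReal.1 this
  have tU : Tendsto (fun ε : ℝ => ∑' n : ℕ, U n / ((n : ℝ) + 1 + ε)) (𝓝[>] 0)
      (𝓝 (∑' n : ℕ, U n / ((n : ℝ) + 1))) := by
    refine tendsto_tsum_of_dominated_convergence hUs (fun n => ?_) ?_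
    · have : ContinuousAt (fun ε : ℝ => U n / ((n : ℝ) + 1 + ε)) 0 := by
        refine ContinuousAt.div (by fun_prop) (by fun_prop) (by positivity)
      simpa using this.tendsto.mono_left nhdsWithin_le_nhds
    · filter_upwards [hmem] with ε hε n
      have h0 := hε.1
      rw [Real.norm_of_nonneg (div_nonneg (hU0 n) (by positivity))]
      exact div_le_div_of_nonneg_left (hU0 n) (by positivity) (by linarith)
  have tL : Tendsto (fun ε : ℝ => ∑' n : ℕ, L n / (a + n - ε)) (𝓝[>] 0)
      (𝓝 (∑' n : ℕ, L n / (a + n))) := by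
    -- The terms increase with `ε`, so the convergent series at `ε = a / 2` dominates all smaller
    -- `ε`.
    refine tendsto_tsum_of_dominated_convergence
      (Gamma_partial_fraction (half_pos ha) (half_lt_self ha) ha1 hb hb1).2.1 (fun n => ?_) ?_
    · have : ContinuousAt (fun ε : ℝ => L n / (a + n - ε)) 0 := by
        refine ContinuousAt.div (by fun_prop) (by fun_prop) ?_
        rw [sub_zero]; positivity
      simpa using this.tendsto.mono_left nhdsWithin_le_nhds
    · filter_upwards [hmem] with ε hε n
      have h0 : (0 : ℝ) ≤ n := n.cast_nonneg
      rw [Real.norm_of_nonneg (div_nonneg (hL0 n) (by linarith))]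
      exact div_le_div_of_nonneg_left (hL0 n) (by linarith) (by linarith)
  have tR := (tU.add (tL.const_mul (Real.Gamma (1 - b) / Real.Gamma (1 - a)))).ofReal
  have hd := (hasDerivAt_Gamma_ratio (a := a) (b := b) ha hb1).tendsto_slope
  have hcast : Tendsto (fun ε : ℝ => (ε : ℂ)) (𝓝[>] 0) (𝓝[≠] 0) := by
    refine tendsto_nhdsWithin_iff.2 ⟨?_, ?_⟩
    · have : Tendsto (fun ε : ℝ => (ε : ℂ)) (𝓝 0) (𝓝 ((0 : ℝ) : ℂ)) :=
        continuous_ofReal.tendsto 0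
      rw [ofReal_zero] at this
      exact this.mono_left nhdsWithin_le_nhds
    · filter_upwards [hmem] with ε hε
      simpa using hε.1.ne'
  have hlim := tendsto_nhds_unique_of_eventuallyEq (hd.comp hcast) tR ?_
  · simp_rw [upperTerm_ofReal]
    rw [hlim]
    push_cast
    simp only [hU, hL, hP, ofReal_ascPochhammer_eval]
    push_cast
    simp only [ofReal_ascPochhammer_eval, ← Gamma_ofReal, div_eq_mul_inv]
    push_cast
    ring
  · filter_upwards [hmem] with ε hε
    obtain ⟨s1, -, e⟩ := Gamma_partial_fraction hε.1 (by linarith : ε < a) ha1 hb hb1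
    -- The `m = 0` term is the singular part `1 / ε`.
    rw [s1.tsum_eq_zero_add] at e
    have hε0 : (ε : ℂ) ≠ 0 := by simpa using hε.1.ne'
    have gA : Gamma (a : ℂ) ≠ 0 := Gamma_ne_zero_of_re_pos (by simpa using ha)
    have gB : Gamma (1 - b : ℂ) ≠ 0 := Gamma_ne_zero_of_re_pos (by simpa using hb1)
    have e' : (∑' n : ℕ, U n / ((n : ℝ) + 1 + ε)) +
        Real.Gamma (1 - b) / Real.Gamma (1 - a) * ∑' n : ℕ, L n / (a + n - ε) =
        Real.Gamma (a - ε) * Real.Gamma ε * Real.Gamma (1 - b) /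
        (Real.Gamma a * Real.Gamma (1 - ε) * Real.Gamma (1 - b + ε)) - 1 / ε := by
      rw [e]
      simp [hU, hL, hP]
      ring
    rw [e']
    push_cast
    simp only [Function.comp, slope_def_field, sub_zero, add_zero, Gamma_one, mul_one,
      ← Gamma_ofReal]
    push_cast
    rw [add_comm 1 (ε : ℂ), Gamma_add_one _ hε0]
    field_simp

theorem regularizedDefect_eq_zero_of_mem_Ioo {a b : ℝ} (ha : 0 < a) (ha1 : a < 1) (hb : 0 < b)
    (hb1 : b < 1) : regularizedDefect a b = 0 := by
  have hA : ∀ m : ℕ, (a : ℂ) ≠ -m := ne_neg_nat_of_re_pos (by simpa using ha)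
  have hB : ∀ m : ℕ, (1 - b : ℂ) ≠ -m := ne_neg_nat_of_re_pos (by simpa using hb1)
  have gA := Gamma_ne_zero hA
  have gB := Gamma_ne_zero hB
  have g1 : Gamma (1 - a : ℂ) ≠ 0 := Gamma_ne_zero_of_re_pos (by simpa using ha1)
  rw [regularizedDefect, deriv_inv_Gamma hA, deriv_inv_Gamma hB,
    tsum_upperTerm_eq_of_mem_Ioo ha ha1 hb hb1]
  simp_rw [lowerTerm_eq hA]
  rw [tsum_mul_left]
  field_simp
  ring

/-! ### Analytic continuation in each variable. -/

theorem differentiableAt_regularizedDefect {f g : ℂ → ℂ} (hf : Differentiable ℂ f)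
    (hg : Differentiable ℂ g) {z : ℂ} (hz : (f z + g z).re < 2) :
    DifferentiableAt ℂ (fun z => regularizedDefect (f z) (g z)) z := by
  have hG := differentiable_one_div_Gamma
  have hG' : Differentiable ℂ (deriv fun z : ℂ => (Gamma z)⁻¹) :=
    (hG.contDiff (n := 2)).differentiable_deriv_two
  have hg1 : Differentiable ℂ fun z => 1 - g z := hg.const_sub 1
  have hf1 : Differentiable ℂ fun z => 1 - f z := hf.const_sub 1
  have a1 := (hG.comp hf) z
  have a2 := (hG.comp hg1) z
  have a3 := (hG.comp hf1) z
  have a4 := (hG'.comp hf) z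
  have a5 := (hG'.comp hg1) z
  exact (((((differentiableAt_tsum_upperTerm hf hg hz).add_const _).mul (a1.mul a2)).sub
    (a4.mul a2)).sub (a1.mul a5)).add (a3.mul (differentiableAt_tsum_lowerTerm hf hg hz))

/-- Identity theorem on a left half plane. -/
theorem eq_zero_of_frequently_of_re_lt {F : ℂ → ℂ} {x : ℝ}
    (hF : ∀ z : ℂ, z.re < x → DifferentiableAt ℂ F z) {z₀ : ℂ} (h₀ : z₀.re < x)
    (hz : ∃ᶠ z in 𝓝[≠] z₀, F z = 0) {z : ℂ} (h : z.re < x) : F z = 0 := by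
  have hopen : IsOpen {z : ℂ | z.re < x} := isOpen_lt continuous_re continuous_const
  have han : AnalyticOnNhd ℂ F {z : ℂ | z.re < x} :=
    DifferentiableOn.analyticOnNhd (fun z hz => (hF z hz).differentiableWithinAt) hopen
  exact han.eqOn_zero_of_preconnected_of_frequently_eq_zero
    (convex_halfSpace_re_lt x).isPreconnected h₀ hz h

theorem frequently_nhdsNE_half_of_real {p : ℂ → Prop} (h : ∀ x : ℝ, 0 < x → x < 1 → p x) :
    ∃ᶠ z in 𝓝[≠] (1 / 2 : ℂ), p z := by
  have hcast : Tendsto (fun ε : ℝ => (ε : ℂ)) (𝓝[≠] (1 / 2)) (𝓝[≠] (1 / 2)) := by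
    refine tendsto_nhdsWithin_iff.2 ⟨?_, ?_⟩
    · have : Tendsto (fun ε : ℝ => (ε : ℂ)) (𝓝 (1 / 2)) (𝓝 ((1 / 2 : ℝ) : ℂ)) :=
        continuous_ofReal.tendsto _
      push_cast at this
      exact this.mono_left nhdsWithin_le_nhds
    · filter_upwards [self_mem_nhdsWithin] with ε hε h
      refine hε ?_
      have : (ε : ℂ) = ((1 / 2 : ℝ) : ℂ) := by rw [h]; push_cast; rfl
      exact ofReal_injective this
  refine hcast.frequently (Eventually.frequently ?_)
  filter_upwards [mem_nhdsWithin_of_mem_nhds (Ioo_mem_nhds (a := (0 : ℝ)) (b := 1)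
    (by norm_num) (by norm_num))] with x hx using h x hx.1 hx.2

theorem regularizedDefect_eq_zero {a b : ℂ} (h : (a + b).re < 2) : regularizedDefect a b = 0 := by
  have hid : Differentiable ℂ fun z : ℂ => z := differentiable_id
  have hconst : ∀ w : ℂ, Differentiable ℂ fun _ : ℂ => w := fun w => differentiable_const w
  have db : ∀ a z : ℂ, z.re < 2 - a.re → DifferentiableAt ℂ (fun b => regularizedDefect a b) z :=
    fun a z hz => differentiableAt_regularizedDefect (hconst a) hid (by rw [add_re]; linarith)
  have da : ∀ b z : ℂ, z.re < 2 - b.re → DifferentiableAt ℂ (fun a => regularizedDefect a b) z :=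
    fun b z hz => differentiableAt_regularizedDefect hid (hconst b) (by rw [add_re]; linarith)
  -- Continue in `b` for real `a` in `(0, 1)`, then in `a` for `re b < 1`, where `re b < 2 - x`
  -- holds for every `x` in `(0, 1)`.
  have s1 : ∀ x : ℝ, 0 < x → x < 1 → ∀ b : ℂ, b.re < 2 - x → regularizedDefect x b = 0 := by
    intro x hx hx1 b hb
    refine eq_zero_of_frequently_of_re_lt (F := fun b => regularizedDefect x b) (db x)
      (z₀ := 1 / 2) (by norm_num; linarith) ?_ (by simpa using hb)
    exact frequently_nhdsNE_half_of_real fun y hy hy1 =>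
      regularizedDefect_eq_zero_of_mem_Ioo hx hx1 hy hy1
  have s2 : ∀ b : ℂ, b.re < 1 → ∀ a : ℂ, a.re < 2 - b.re → regularizedDefect a b = 0 := by
    intro b hb a ha
    refine eq_zero_of_frequently_of_re_lt (F := fun a => regularizedDefect a b) (da b)
      (z₀ := 1 / 2) (by norm_num; linarith) ?_ ha
    exact frequently_nhdsNE_half_of_real fun x hx hx1 => s1 x hx hx1 b (by linarith)
  rw [add_re] at h
  -- A last continuation in `b` removes `re b < 1`; near the chosen base point both `re b < 1` and
  -- `re (a + b) < 2` hold.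
  refine eq_zero_of_frequently_of_re_lt (F := fun b => regularizedDefect a b) (db a)
    (z₀ := ((min 1 (2 - a.re) - 1 : ℝ) : ℂ)) ?_ (Eventually.frequently ?_) (by linarith)
  · rw [ofReal_re]; linarith [min_le_right 1 (2 - a.re)]
  · refine mem_nhdsWithin_of_mem_nhds ?_
    filter_upwards [(isOpen_lt continuous_re continuous_const).mem_nhds
      (show ((min 1 (2 - a.re) - 1 : ℝ) : ℂ).re < min 1 (2 - a.re) by rw [ofReal_re]; linarith)]
      with b hb
    exact s2 b (lt_of_lt_of_le hb (min_le_left _ _)) a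
      (by linarith [lt_of_lt_of_le hb (min_le_right 1 (2 - a.re))])

theorem tsum_upperTerm_eq {a b : ℂ} (h : (a + b).re < 2) (ha : ∀ m : ℕ, a ≠ -m)
    (hb : ∀ m : ℕ, 1 - b ≠ -m) :
    ∑' n, upperTerm a b n = -(2 * Real.eulerMascheroniConstant + digamma a + digamma (1 - b)) -
      Gamma a * Gamma (1 - b) * (Gamma (1 - a))⁻¹ * ∑' n, lowerTerm a b n := by
  have gA := Gamma_ne_zero ha
  have gB := Gamma_ne_zero hb
  have := regularizedDefect_eq_zero h
  rw [regularizedDefect, deriv_inv_Gamma ha, deriv_inv_Gamma hb] at this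
  have h2 := congrArg (fun x => Gamma a * Gamma (1 - b) * x) this
  simp only [mul_zero] at h2
  rw [← sub_eq_zero, ← h2]
  field_simp
  ring

/-! ### Translation to hypergeometric series. -/

theorem hypergeomTerm_upper {c d : ℂ} (hc : c ≠ 1) (hd : d ≠ 1) (n : ℕ) :
    hypergeomTerm [1, 1, c, d] [2, 2, 2] 1 n =
      ((c - 1) * (d - 1))⁻¹ * upperTerm (c - 1) (d - 1) n := by
  have hp : ∀ x : ℂ, (ascPochhammer ℂ (n + 1)).eval (x - 1) =
      (x - 1) * (ascPochhammer ℂ n).eval x := by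
    intro x
    rw [ascPochhammer_succ_left]
    simp
  have h1 : (ascPochhammer ℂ n).eval 1 = n.factorial := by
    simp
  have h2 : (ascPochhammer ℂ n).eval 2 = (n + 1).factorial := by
    have := hp 2
    rw [show (2 : ℂ) - 1 = 1 by norm_num, ascPochhammer_eval_one, one_mul] at this
    exact this.symm
  have hf : (n.factorial : ℂ) ≠ 0 := by exact_mod_cast n.factorial_ne_zero
  have hn : (n : ℂ) + 1 ≠ 0 := Nat.cast_add_one_ne_zero n
  have hc' := sub_ne_zero.2 hc
  have hd' := sub_ne_zero.2 hd
  rw [hypergeomTerm, upperTerm, hp, hp]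
  simp only [List.map_cons, List.map_nil, List.prod_cons, List.prod_nil, h1, h2, mul_one, one_pow,
    Nat.factorial_succ]
  push_cast
  field_simp

theorem hypergeomTerm_lower {a b : ℂ} (ha : ∀ m : ℕ, a ≠ -m) (hab : ∀ m : ℕ, 1 + a - b ≠ -m)
    (n : ℕ) :
    hypergeomTerm [a, a, a] [a + 1, 1 + a - b] 1 n =
      a * Gamma a * Gamma (1 + a - b) * lowerTerm a b n := by
  have hf : (n.factorial : ℂ) ≠ 0 := by exact_mod_cast n.factorial_ne_zero
  have ha0 : a ≠ 0 := by simpa using ha 0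
  have ha1 : ∀ m : ℕ, a + 1 ≠ -m := fun m h => ha (m + 1) (by push_cast; linear_combination h)
  have g0 := Gamma_ne_zero ha1
  have g1 := Gamma_ne_zero hab
  have e1 := Gamma_add_nat_div_Gamma_eq (n := n) (a + 1) ha1
  have e2 := Gamma_add_nat_div_Gamma_eq (n := n) (1 + a - b) hab
  rw [hypergeomTerm, lowerTerm]
  simp only [List.map_cons, List.map_nil, List.prod_cons, List.prod_nil, mul_one, one_pow,
    ← e1, ← e2]
  rw [Gamma_add_one a ha0] at g0 ⊢
  rw [show a + n + 1 = a + 1 + n by ring, show a - b + n + 1 = 1 + a - b + n by ring]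
  field_simp

theorem mainTheorem2 (c d : ℂ)
    (hconv : (c + d).re < 4)
    (hc : ∀ m : ℕ, c ≠ 1 - (m : ℂ))
    (hd : ∀ m : ℕ, d ≠ 1 + (m : ℂ))
    (hcd : ∀ m : ℕ, 1 + c - d ≠ -(m : ℂ)) :
    Summable (hypergeomTerm [1, 1, c, d] [2, 2, 2] 1) ∧
    Summable (hypergeomTerm [c - 1, c - 1, c - 1] [c, 1 + c - d] 1) ∧
    hypergeom [1, 1, c, d] [2, 2, 2] 1 =
      -(Complex.sin ((Real.pi : ℂ) * c) * Complex.Gamma c * Complex.Gamma (1 - d) *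
          hypergeom [c - 1, c - 1, c - 1] [c, 1 + c - d] 1 /
            (Complex.Gamma (1 + c - d) * (c - 1) ^ 3 * (Real.pi : ℂ)))
        - (2 * (Real.eulerMascheroniConstant : ℂ) + Complex.digamma (c - 1)
            + Complex.digamma (2 - d)) / ((c - 1) * (d - 1)) := by
  have hc1 : c ≠ 1 := by simpa using hc 0
  have hd1 : d ≠ 1 := by simpa using hd 0
  have hc0 := sub_ne_zero.2 hc1
  have hd0 := sub_ne_zero.2 hd1
  have hA : ∀ m : ℕ, c - 1 ≠ -m := fun m h => hc m (by linear_combination h)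
  have hB : ∀ m : ℕ, 1 - (d - 1) ≠ -m := fun m h =>
    hd (m + 1) (by push_cast; linear_combination -h)
  have hAB : ∀ m : ℕ, 1 + (c - 1) - (d - 1) ≠ -m := fun m h =>
    hcd m (by linear_combination h)
  have hre : ((c - 1) + (d - 1)).re < 2 := by
    simp only [add_re, sub_re, one_re] at hconv ⊢; linarith
  have t1 : hypergeomTerm [1, 1, c, d] [2, 2, 2] 1 =
      fun n => ((c - 1) * (d - 1))⁻¹ * upperTerm (c - 1) (d - 1) n :=
    funext (hypergeomTerm_upper hc1 hd1)
  have t2 : hypergeomTerm [c - 1, c - 1, c - 1] [c, 1 + c - d] 1 =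
      fun n => (c - 1) * Gamma (c - 1) * Gamma (1 + c - d) * lowerTerm (c - 1) (d - 1) n := by
    have := funext (hypergeomTerm_lower hA hAB)
    rwa [sub_add_cancel, show 1 + (c - 1) - (d - 1) = 1 + c - d by ring] at this
  refine ⟨?_, ?_, ?_⟩
  · rw [t1]; exact (summable_upperTerm hre).mul_left _
  · rw [t2]; exact (summable_lowerTerm hre).mul_left _
  have gA := Gamma_ne_zero hA
  have gAB := Gamma_ne_zero hcd
  have gc : Gamma c = (c - 1) * Gamma (c - 1) := by
    rw [← Gamma_add_one _ hc0, sub_add_cancel]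
  have gd : Gamma (1 - (d - 1)) = (1 - d) * Gamma (1 - d) := by
    rw [← Gamma_add_one _ (sub_ne_zero.2 hd1.symm)]; congr 1; ring
  -- Reflection formula. It also covers `c = 2, 3, …`, where `Gamma (1 - (c - 1))` takes its default
  -- value `0` and the sine vanishes.
  have gs : (Gamma (1 - (c - 1)))⁻¹ = -(Gamma (c - 1) * Complex.sin (Real.pi * c) / Real.pi) := by
    have h1 := Gamma_mul_Gamma_one_sub (c - 1)
    have h2 : Complex.sin (Real.pi * (c - 1)) = -Complex.sin (Real.pi * c) := by
      rw [mul_sub, mul_one, Complex.sin_sub_pi]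
    rw [h2] at h1
    have h3 : Gamma (1 - (c - 1)) = (Gamma (c - 1))⁻¹ * (Real.pi / -Complex.sin (Real.pi * c)) := by
      rw [← h1]; field_simp
    rw [h3, mul_inv, inv_inv, inv_div]
    ring
  have hpi : (Real.pi : ℂ) ≠ 0 := by exact_mod_cast Real.pi_ne_zero
  rw [hypergeom, hypergeom, t1, t2, tsum_mul_left, tsum_mul_left, tsum_upperTerm_eq hre hA hB, gs,
    gd, gc, show 1 - (d - 1) = 2 - d by ring]
  field_simp
  ring
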